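/- Let $G$ be an infinite, connected, locally finite graph without loops or multiple edges, with Laplacian $\Delta f(x)=\sum_{y\sim x}(f(x)-f(y))$. Let $p_t(x,y)$ be its (minimal) heat kernel, i.e. the supremum over all finite sets $D$ of vertices (equivalently, the limit along any exhaustion by finite sets) of the kernels of $e^{-t\Delta_D}$, extended by zero, where $\Delta_D$ is the restriction of $\Delta$ to $D$ with Dirichlet boundary conditions. Call $G$ stochastically incomplete if $\sum_y p_t(x,y)<1$ for some $t>0$ and some vertex $x$. Fix a vertex $x_0$. For $r\ge 0$ let $S(r)$ be the number of vertices at distance exactly $r$ from $x_0$ and $V(r)=\sum_{i=0}^r S(i)$. Suppose that $G$ is spherically symmetric about $x_0$: there are functions $k_\pm$ of $r$ such that every vertex $x$ at distance $r$ from $x_0$ has exactly $k_+(r)$ neighbours at distance $r+1$ from $x_0$ and exactly $k_-(r)$ neighbours at distance $r-1$ from $x_0$ (no assumption is made on the number of neighbours at distance $r$). Then $G$ is stochastically incomplete if and only if $$\sum_{r=0}^\infty \frac{V(r)}{k_+(r)\,S(r)}<\infty .$$ -/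

import Mathlib

open scoped ENNReal

namespace SimpleGraph

variable {V : Type*}

/-- The (positive) graph Laplacian `Δ f (x) = ∑_{y ∼ x} (f x - f y)` on a locally finite graph. -/
noncomputable def laplacian (G : SimpleGraph V) [G.LocallyFinite] (f : V → ℝ) (x : V) : ℝ :=
  ∑ y ∈ G.neighborFinset x, (f x - f y)

open scoped Classical in
/-- The Laplacian with Dirichlet boundary conditions on a finite set `D` of vertices: `Δ` acting on
the functions that vanish outside `D`, followed by restriction to `D`, as a matrix indexed by `D`
(column `y` is `Δ` of the indicator function of `y`). -/
noncomputable def dirichletLaplacian (G : SimpleGraph V) [G.LocallyFinite] (D : Finset V) :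
    Matrix D D ℝ :=
  Matrix.of fun x y => G.laplacian (Pi.single (y : V) (1 : ℝ)) (x : V)

open scoped Classical in
/-- The Dirichlet heat kernel of a finite set `D`: the kernel of `exp (-t Δ_D)`, extended by zero
to all pairs of vertices. -/
noncomputable def dirichletHeatKernel (G : SimpleGraph V) [G.LocallyFinite] (D : Finset V)
    (t : ℝ) (x y : V) : ℝ :=
  if h : x ∈ D ∧ y ∈ D then
    (NormedSpace.exp (-(t • G.dirichletLaplacian D)) : Matrix D D ℝ) ⟨x, h.1⟩ ⟨y, h.2⟩
  else 0

/-- The (minimal) heat kernel `p_t(x, y)`, constructed by exhaustion. For `t ≥ 0` the Dirichlet heat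
kernels are non-negative and increase with the finite set `D`, so their limit along any exhaustion
of the graph by finite sets is the supremum over all finite sets. -/
noncomputable def heatKernel (G : SimpleGraph V) [G.LocallyFinite] (t : ℝ) (x y : V) : ℝ≥0∞ :=
  ⨆ D : Finset V, ENNReal.ofReal (G.dirichletHeatKernel D t x y)

/-- Stochastic incompleteness: the total mass of the heat kernel is less than one for some time
`t > 0` and some starting vertex. -/
def StochasticallyIncomplete (G : SimpleGraph V) [G.LocallyFinite] : Prop :=
  ∃ t : ℝ, 0 < t ∧ ∃ x : V, ∑' y : V, G.heatKernel t x y < 1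

/-- The number `m₊(x)` of neighbours of `x` one step further from `x₀` than `x`. -/
noncomputable def outerDegree (G : SimpleGraph V) (x₀ x : V) : ℕ :=
  {y : V | G.Adj x y ∧ G.dist x₀ y = G.dist x₀ x + 1}.ncard

/-- The number `m₋(x)` of neighbours of `x` one step closer to `x₀` than `x`. -/
noncomputable def innerDegree (G : SimpleGraph V) (x₀ x : V) : ℕ :=
  {y : V | G.Adj x y ∧ G.dist x₀ y + 1 = G.dist x₀ x}.ncard

/-- `G` is spherically symmetric about `x₀` with `m₊(x) = k₊(r)` and `m₋(x) = k₋(r)` for every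
vertex `x` at distance `r` from `x₀`. Nothing is asked of the edges inside the spheres. -/
def IsSphericallySymmetric (G : SimpleGraph V) (x₀ : V) (kPlus kMinus : ℕ → ℕ) : Prop :=
  ∀ x : V, G.outerDegree x₀ x = kPlus (G.dist x₀ x) ∧ G.innerDegree x₀ x = kMinus (G.dist x₀ x)

/-- `S(r)`: the number of vertices at distance exactly `r` from `x₀`. -/
noncomputable def sphereArea (G : SimpleGraph V) (x₀ : V) (r : ℕ) : ℕ :=
  {x : V | G.dist x₀ x = r}.ncard

/-- `V(r) = S(0) + ⋯ + S(r)`: the number of vertices at distance at most `r` from `x₀`. -/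
noncomputable def ballVolume (G : SimpleGraph V) (x₀ : V) (r : ℕ) : ℕ :=
  ∑ i ∈ Finset.range (r + 1), G.sphereArea x₀ i

end SimpleGraph

/-! Everything rests on one radial function: the partial sums `v` of the series, taken up to the
distance from `x₀`, satisfy `Δ v = -1` (`laplacian_sum_range`). Hence `v + t` times a positive
constant, or its negative, plus a constant solves the heat equation, and it can be compared with the
Dirichlet semigroups (`add_mul_le_sum_dirichletHeatKernel`). If the series converges, `v ≤ M`, and
the mass at time `T` is at most `(M - v x) / T`, which is below one for large `T`. If it diverges,
`v` tends to infinity along balls, and the mass is at least `1 - (T + v x) / R` for arbitrarily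
large `R`, hence at least one. -/

namespace Matrix

/-! ### Exponentials of matrices with non-negative off-diagonal entries -/

variable {m n : Type*} [Fintype m] [DecidableEq m] [Fintype n] [DecidableEq n]

attribute [local instance] Matrix.linftyOpNormedRing Matrix.linftyOpNormedAlgebra

theorem submatrix_pow_apply_le {B : Matrix m m ℝ} (hB : ∀ i j, 0 ≤ B i j) (e : n ↪ m) (k : ℕ)
    (i j : n) : (B.submatrix e e ^ k) i j ≤ (B ^ k) (e i) (e j) := by
  induction k generalizing i j with
  | zero => simp [Matrix.one_apply]
  | succ k ih =>
    rw [pow_succ, Matrix.mul_apply, pow_succ, Matrix.mul_apply]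
    calc ∑ l, (B.submatrix e e ^ k) i l * B.submatrix e e l j
        ≤ ∑ l, (B ^ k) (e i) (e l) * B (e l) (e j) :=
          Finset.sum_le_sum fun l _ => mul_le_mul_of_nonneg_right (ih i l) (hB _ _)
      _ = ∑ l ∈ Finset.univ.map e, (B ^ k) (e i) l * B l (e j) := by rw [Finset.sum_map]
      _ ≤ ∑ l, (B ^ k) (e i) l * B l (e j) :=
          Finset.sum_le_sum_of_subset_of_nonneg (Finset.subset_univ _) fun l _ _ =>
            mul_nonneg (pow_apply_nonneg hB k _ _) (hB _ _)

theorem hasSum_exp_apply (B : Matrix m m ℝ) (i j : m) :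
    HasSum (fun k : ℕ => (k.factorial : ℝ)⁻¹ * (B ^ k) i j) (NormedSpace.exp B i j) := by
  have h := NormedSpace.exp_series_hasSum_exp' (𝕂 := ℝ) B
  exact h.mapL (LinearMap.toContinuousLinearMap (Matrix.entryLinearMap ℝ ℝ i j))

theorem exp_sub_smul_one (B : Matrix m m ℝ) (c : ℝ) :
    NormedSpace.exp (B - c • (1 : Matrix m m ℝ)) = Real.exp (-c) • NormedSpace.exp B := by
  have hc : NormedSpace.exp (-c • (1 : Matrix m m ℝ)) = Real.exp (-c) • (1 : Matrix m m ℝ) := by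
    rw [← Algebra.algebraMap_eq_smul_one, ← Algebra.algebraMap_eq_smul_one, Real.exp_eq_exp_ℝ]
    exact (NormedSpace.algebraMap_exp_comm (𝕂 := ℝ) (𝔸 := Matrix m m ℝ) (-c)).symm
  rw [sub_eq_add_neg, ← neg_smul, Matrix.exp_add_of_commute, hc, mul_smul_comm, mul_one]
  exact (Commute.one_right B).smul_right _

/-- Such a shift only rescales the exponential (`exp_sub_smul_one`), so its sign and monotonicity
can be read off a power series with non-negative terms. -/
theorem exists_add_smul_one_nonneg {A : Matrix m m ℝ} (hA : ∀ i j, i ≠ j → 0 ≤ A i j) :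
    ∃ c : ℝ, ∀ i j, 0 ≤ (A + c • (1 : Matrix m m ℝ)) i j := by
  refine ⟨∑ i, |A i i|, fun i j => ?_⟩
  rcases eq_or_ne i j with rfl | h
  · have h1 := Finset.single_le_sum (f := fun i => |A i i|) (fun l _ => abs_nonneg _)
      (Finset.mem_univ i)
    have h2 := neg_abs_le (A i i)
    simp only [add_apply, smul_apply, one_apply_eq, smul_eq_mul, mul_one]
    linarith
  · simpa [Matrix.one_apply_ne h] using hA i j h

/-- The exponential of a matrix with non-negative off-diagonal entries has non-negative entries. -/
theorem exp_apply_nonneg {A : Matrix m m ℝ} (hA : ∀ i j, i ≠ j → 0 ≤ A i j) (i j : m) :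
    0 ≤ NormedSpace.exp A i j := by
  obtain ⟨c, hc⟩ := exists_add_smul_one_nonneg hA
  have h := exp_sub_smul_one (A + c • 1) c
  rw [add_sub_cancel_right] at h
  rw [h, smul_apply, smul_eq_mul]
  exact mul_nonneg (Real.exp_nonneg _) ((hasSum_exp_apply _ i j).nonneg fun k =>
    mul_nonneg (by positivity) (pow_apply_nonneg hc k i j))

/-- Passing to a principal submatrix decreases the exponential of a matrix with non-negative
off-diagonal entries. -/
theorem exp_submatrix_apply_le {A : Matrix m m ℝ} (hA : ∀ i j, i ≠ j → 0 ≤ A i j) (e : n ↪ m)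
    (i j : n) : NormedSpace.exp (A.submatrix e e) i j ≤ NormedSpace.exp A (e i) (e j) := by
  obtain ⟨c, hc⟩ := exists_add_smul_one_nonneg hA
  have h := exp_sub_smul_one (A + c • 1) c
  have h' := exp_sub_smul_one ((A + c • 1).submatrix e e) c
  rw [add_sub_cancel_right] at h
  have h1 : (A + c • 1).submatrix e e - c • 1 = A.submatrix e e := by
    ext i j
    simp [Matrix.one_apply]
  rw [h1] at h'
  rw [h, h', smul_apply, smul_apply, smul_eq_mul, smul_eq_mul]
  refine mul_le_mul_of_nonneg_left ?_ (Real.exp_nonneg _)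
  exact hasSum_le (fun k => mul_le_mul_of_nonneg_left (submatrix_pow_apply_le hc e k i j)
    (by positivity)) (hasSum_exp_apply _ i j) (hasSum_exp_apply _ _ _)

/-- Comparison of a subsolution of `w' = A w` that is affine in time with the solution. -/
theorem add_smul_le_exp_mulVec {A : Matrix m m ℝ} (hA : ∀ i j, i ≠ j → 0 ≤ A i j) {f g : m → ℝ}
    {T : ℝ} (hT : 0 ≤ T) (hg : ∀ t, 0 ≤ t → t ≤ T → g ≤ A *ᵥ (f + t • g)) :
    f + T • g ≤ NormedSpace.exp (T • A) *ᵥ f := by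
  intro i
  -- Duhamel interpolation: `F 0` is the right-hand side and `F T` the left-hand side. The
  -- derivative is `E s` applied to `g - A (f + s g) ≤ 0`, and `E s` preserves signs.
  set E : ℝ → Matrix m m ℝ := fun s => NormedSpace.exp ((T - s) • A) with hE
  set F : ℝ → ℝ := fun s => (E s *ᵥ (f + s • g)) i with hF
  have hEij : ∀ s j, HasDerivAt (fun s => E s i j) (-(E s * A) i j) s := fun s j => by
    have h := hasDerivAt_exp_smul_const (𝕂 := ℝ) A (T - s)
    have h2 := (h.scomp s ((hasDerivAt_id s).const_sub T))
    have h3 := (LinearMap.toContinuousLinearMap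
      (Matrix.entryLinearMap ℝ ℝ i j)).hasFDerivAt.comp_hasDerivAt s h2
    refine h3.congr_deriv ?_
    rw [neg_one_smul]
    rfl
  have hFd : ∀ s, HasDerivAt F ((E s *ᵥ (g - A *ᵥ (f + s • g))) i) s := fun s => by
    have hj : ∀ j, HasDerivAt (fun s => E s i j * (f j + s * g j))
        (-(E s * A) i j * (f j + s * g j) + E s i j * g j) s := fun j => by
      have := (hEij s j).fun_mul (((hasDerivAt_id' s).mul_const (g j)).const_add (f j))
      rwa [one_mul] at this
    have := HasDerivAt.fun_sum (u := Finset.univ) fun j _ => hj j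
    have e : (E s *ᵥ (g - A *ᵥ (f + s • g))) i
        = ∑ j, (-(E s * A) i j * (f j + s * g j) + E s i j * g j) := by
      rw [Matrix.mulVec_sub, Matrix.mulVec_mulVec, Finset.sum_add_distrib]
      simp [Matrix.mulVec, dotProduct, sub_eq_neg_add]
    rw [e]
    simpa [hF, Matrix.mulVec, dotProduct] using this
  have hanti : AntitoneOn F (Set.Icc 0 T) := by
    refine antitoneOn_of_deriv_nonpos (convex_Icc 0 T)
      (fun s _ => (hFd s).continuousAt.continuousWithinAt)
      (fun s _ => (hFd s).differentiableAt.differentiableWithinAt) fun s hs => ?_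
    rw [interior_Icc] at hs
    rw [(hFd s).deriv]
    refine Finset.sum_nonpos fun j _ => mul_nonpos_of_nonneg_of_nonpos ?_ ?_
    · refine exp_apply_nonneg (fun a b hab => ?_) i j
      exact mul_nonneg (sub_nonneg.2 hs.2.le) (hA a b hab)
    · exact sub_nonpos.2 (hg s hs.1.le hs.2.le j)
  have := hanti (Set.left_mem_Icc.2 hT) (Set.right_mem_Icc.2 hT) hT
  simpa [hF, hE] using this

end Matrix

namespace SimpleGraph

variable {V : Type*} {G : SimpleGraph V}

/-! ### Dirichlet heat kernels and comparison with functions satisfying `Δ v = -1` -/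

section Heat

variable [G.LocallyFinite]

theorem laplacian_mono_of_eq {f g : V → ℝ} {x : V} (hx : f x = g x) (h : ∀ y, f y ≤ g y) :
    G.laplacian g x ≤ G.laplacian f x :=
  Finset.sum_le_sum fun y _ => by have := h y; linarith

open scoped Classical in
theorem dirichletLaplacian_mulVec (D : Finset V) (f : V → ℝ) (x : D) :
    (G.dirichletLaplacian D).mulVec (fun y : D => f y) x
      = G.laplacian (fun y => if y ∈ D then f y else 0) x := by
  have hf : ∀ z, (if z ∈ D then f z else 0) =
      ∑ y : D, (Pi.single (y : V) (1 : ℝ) : V → ℝ) z * f y := by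
    intro z
    rw [Finset.sum_coe_sort D fun y => (Pi.single (y : V) (1 : ℝ) : V → ℝ) z * f y]
    simp [Pi.single_apply]
  simp only [Matrix.mulVec, dotProduct, dirichletLaplacian, Matrix.of_apply, laplacian, hf,
    Finset.sum_mul, sub_mul, ← Finset.sum_sub_distrib]
  rw [Finset.sum_comm]

open scoped Classical in
theorem neg_dirichletLaplacian_apply_nonneg (D : Finset V) (i j : D) (h : i ≠ j) :
    0 ≤ (-G.dirichletLaplacian D) i j := by
  have h' : (i : V) ≠ j := fun e => h (Subtype.ext e)
  rw [Matrix.neg_apply, dirichletLaplacian, Matrix.of_apply, laplacian, neg_nonneg]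
  refine Finset.sum_nonpos fun y _ => ?_
  rw [Pi.single_eq_of_ne h', zero_sub, neg_nonpos, Pi.single_apply]
  split_ifs <;> norm_num

theorem smul_neg_dirichletLaplacian_apply_nonneg (D : Finset V) {t : ℝ} (ht : 0 ≤ t) (i j : D)
    (h : i ≠ j) : 0 ≤ (t • -G.dirichletLaplacian D) i j :=
  mul_nonneg ht (neg_dirichletLaplacian_apply_nonneg D i j h)

open scoped Classical in
theorem dirichletHeatKernel_of_mem {D : Finset V} (t : ℝ) {x y : V} (hx : x ∈ D) (hy : y ∈ D) :
    G.dirichletHeatKernel D t x y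
      = NormedSpace.exp (t • -G.dirichletLaplacian D) ⟨x, hx⟩ ⟨y, hy⟩ := by
  rw [dirichletHeatKernel, dif_pos ⟨hx, hy⟩, smul_neg]

theorem dirichletHeatKernel_nonneg (D : Finset V) {t : ℝ} (ht : 0 ≤ t) (x y : V) :
    0 ≤ G.dirichletHeatKernel D t x y := by
  classical
  by_cases h : x ∈ D ∧ y ∈ D
  · rw [dirichletHeatKernel_of_mem t h.1 h.2]
    convert Matrix.exp_apply_nonneg (smul_neg_dirichletLaplacian_apply_nonneg D ht) _ _
  · rw [dirichletHeatKernel, dif_neg h]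

theorem dirichletHeatKernel_mono {t : ℝ} (ht : 0 ≤ t) (x y : V) :
    Monotone fun D => G.dirichletHeatKernel D t x y := by
  classical
  intro D D' hD
  by_cases h : x ∈ D ∧ y ∈ D
  · simp only
    rw [dirichletHeatKernel_of_mem t h.1 h.2, dirichletHeatKernel_of_mem t (hD h.1) (hD h.2)]
    have h' := Matrix.exp_submatrix_apply_le
      (smul_neg_dirichletLaplacian_apply_nonneg (G := G) D' ht)
      (Subtype.impEmbedding (· ∈ D) (· ∈ D') hD) ⟨x, h.1⟩ ⟨y, h.2⟩
    convert h' <;> rfl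
  · simp only
    rw [dirichletHeatKernel, dif_neg h]
    exact dirichletHeatKernel_nonneg D' ht x y

theorem sum_dirichletHeatKernel {D : Finset V} (t : ℝ) {x : V} (hx : x ∈ D) [DecidableEq D] :
    ∑ y ∈ D, G.dirichletHeatKernel D t x y
      = (NormedSpace.exp (t • -G.dirichletLaplacian D)).mulVec (fun _ => 1) ⟨x, hx⟩ := by
  classical
  rw [← Finset.sum_coe_sort]
  simp only [Matrix.mulVec, dotProduct, mul_one]
  refine Finset.sum_congr rfl fun y _ => ?_
  rw [dirichletHeatKernel_of_mem t hx y.2]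
  congr!

theorem tsum_heatKernel_le {t : ℝ} (ht : 0 ≤ t) {x : V} {C : ℝ}
    (h : ∀ D : Finset V, x ∈ D → ∑ y ∈ D, G.dirichletHeatKernel D t x y ≤ C) :
    ∑' y, G.heatKernel t x y ≤ ENNReal.ofReal C := by
  classical
  rw [ENNReal.tsum_eq_iSup_sum]
  refine iSup_le fun s => ?_
  simp only [heatKernel]
  rw [ENNReal.finsetSum_iSup_of_monotone fun y D D' hD =>
    ENNReal.ofReal_le_ofReal (dirichletHeatKernel_mono ht x y hD)]
  refine iSup_le fun D => ?_
  rw [← ENNReal.ofReal_sum_of_nonneg fun y _ => dirichletHeatKernel_nonneg D ht x y]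
  refine ENNReal.ofReal_le_ofReal ?_
  -- The hypothesis sums over the same set that defines the kernel, so both `D` and `s` are enlarged
  -- to `D'`.
  set D' := insert x (D ∪ s)
  refine le_trans ?_ (h D' (Finset.mem_insert_self _ _))
  refine (Finset.sum_le_sum fun y _ => dirichletHeatKernel_mono ht x y (?_ : D ≤ D')).trans
    (Finset.sum_le_sum_of_subset_of_nonneg ?_ fun y _ _ => dirichletHeatKernel_nonneg D' ht x y)
  · exact Finset.subset_union_left.trans (Finset.subset_insert _ _)
  · exact Finset.subset_union_right.trans (Finset.subset_insert _ _)

theorem sum_dirichletHeatKernel_le_tsum (D : Finset V) {t : ℝ} (ht : 0 ≤ t) (x : V) :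
    ENNReal.ofReal (∑ y ∈ D, G.dirichletHeatKernel D t x y) ≤ ∑' y, G.heatKernel t x y := by
  rw [ENNReal.ofReal_sum_of_nonneg fun y _ => dirichletHeatKernel_nonneg D ht x y]
  exact (Finset.sum_le_sum fun y _ =>
    le_iSup (fun D => ENNReal.ofReal (G.dirichletHeatKernel D t x y)) D).trans
    (ENNReal.sum_le_tsum (f := fun y => G.heatKernel t x y) D)

/-- Comparison of the subsolution `f + t c` of the heat equation with the Dirichlet heat kernel. -/
theorem add_mul_le_sum_dirichletHeatKernel {f : V → ℝ} {c K T : ℝ}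
    (hf : ∀ x, G.laplacian f x = -c) (hK : ∀ x, f x ≤ K) (hT : 0 ≤ T) {D : Finset V}
    (hD : ∀ t, 0 ≤ t → t ≤ T → ∀ x, x ∉ D → f x + t * c ≤ 0) {x : V} (hx : x ∈ D) :
    f x + T * c ≤ K * ∑ y ∈ D, G.dirichletHeatKernel D T x y := by
  classical
  have h := Matrix.add_smul_le_exp_mulVec (neg_dirichletLaplacian_apply_nonneg (G := G) D)
    (f := fun x : D => f x) (g := fun _ => c) hT fun t ht htT i => ?_
  · refine (h ⟨x, hx⟩).trans ?_
    rw [sum_dirichletHeatKernel T hx]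
    simp only [Matrix.mulVec, dotProduct, Finset.mul_sum]
    refine Finset.sum_le_sum fun j _ => ?_
    rw [mul_one, mul_comm]
    exact mul_le_mul_of_nonneg_right (hK j)
      (Matrix.exp_apply_nonneg (smul_neg_dirichletLaplacian_apply_nonneg D hT) _ _)
  · have h1 := dirichletLaplacian_mulVec (G := G) D (fun y => f y + t * c) i
    have h2 : G.laplacian (fun y => f y + t * c) i = -c := by
      rw [← hf i]
      exact Finset.sum_congr rfl fun y _ => by ring
    -- Cutting off outside `D` raises the function there, where it is `≤ 0`, and keeps its value at
    -- `i`; so the Laplacian at `i` can only decrease.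
    have h3 : G.laplacian (fun y => if y ∈ D then f y + t * c else 0) i
        ≤ G.laplacian (fun y => f y + t * c) i := by
      refine laplacian_mono_of_eq (by simp) fun y => ?_
      split_ifs with hy
      · exact le_rfl
      · exact hD t ht htT y hy
    rw [Matrix.neg_mulVec]
    change c ≤ -((G.dirichletLaplacian D).mulVec (fun y : D => f y + t * c) i)
    linarith

/-- A function `v ≤ M` with `Δ v = -1` bounds the mass of the heat kernel from above. -/
theorem sum_dirichletHeatKernel_le {v : V → ℝ} (hv : ∀ x, G.laplacian v x = -1) {M T : ℝ}
    (hM : ∀ x, v x ≤ M) (hT : 0 < T) {D : Finset V} {x : V} (hx : x ∈ D) :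
    ∑ y ∈ D, G.dirichletHeatKernel D T x y ≤ (M - v x) / T := by
  -- The function `-1 + (v - M + t) / T` is at most `-1` at time `0` and stays `≤ 0` up to time `T`.
  -- The negative `K` turns the lower comparison into an upper bound on the mass.
  have h := add_mul_le_sum_dirichletHeatKernel (G := G) (f := fun x => -1 + (v x - M) / T)
    (c := 1 / T) (K := -1) (T := T) (fun x => ?_) (fun x => ?_) hT.le (D := D)
    (fun t _ htT y _ => ?_) hx
  · have h' : -1 + (v x - M) / T + T * (1 / T) = -((M - v x) / T) := by field_simp; ring
    linarith
  · rw [← neg_div, ← hv x, laplacian, laplacian, Finset.sum_div]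
    exact Finset.sum_congr rfl fun y _ => by ring
  · have := div_nonpos_of_nonpos_of_nonneg (sub_nonpos.2 (hM x)) hT.le
    linarith
  · have : -1 + (v y - M) / T + t * (1 / T) = ((t - T) + (v y - M)) / T := by field_simp; ring
    rw [this]
    exact div_nonpos_of_nonpos_of_nonneg (by linarith [hM y]) hT.le

/-- A function `v ≥ 0` with `Δ v = -1` that is at least `R` outside of a finite set bounds the mass
of the heat kernel from below. -/
theorem le_sum_dirichletHeatKernel {v : V → ℝ} (hv : ∀ x, G.laplacian v x = -1) {R T : ℝ}
    (hv0 : ∀ x, 0 ≤ v x) (hR : 0 < R) (hT : 0 ≤ T) {D : Finset V} (hD : ∀ x, x ∉ D → R ≤ v x)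
    {x : V} (hx : x ∈ D) :
    1 - (T + v x) / R ≤ ∑ y ∈ D, G.dirichletHeatKernel D T x y := by
  -- The function `1 - (v + t) / R` is at most `1` initially and `≤ 0` outside `D`, where `v ≥ R`.
  have h := add_mul_le_sum_dirichletHeatKernel (G := G) (f := fun x => 1 - v x / R)
    (c := -(1 / R)) (K := 1) (T := T) (fun x => ?_) (fun x => ?_) hT (D := D)
    (fun t ht _ y hy => ?_) hx
  · have h' : 1 - v x / R + T * (-(1 / R)) = 1 - (T + v x) / R := by ring
    linarith
  · have : -(-(1 / R)) = -(G.laplacian v x / R) := by rw [hv]; ring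
    rw [this, laplacian, laplacian, Finset.sum_div, ← Finset.sum_neg_distrib]
    exact Finset.sum_congr rfl fun y _ => by ring
  · have := div_nonneg (hv0 x) hR.le
    linarith
  · have h1 : 1 ≤ v y / R := (one_le_div hR).2 (hD y hy)
    have h2 : 0 ≤ t * (1 / R) := by positivity
    linarith

end Heat

/-! ### Spheres, balls and radial functions -/

section Spheres

theorem Connected.exists_adj_dist_add_one (hG : G.Connected) {x₀ y : V} {r : ℕ}
    (h : G.dist x₀ y = r + 1) : ∃ z, G.Adj z y ∧ G.dist x₀ z = r := by
  obtain ⟨p, hp⟩ := hG.exists_walk_length_eq_dist y x₀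
  rw [dist_comm, h] at hp
  cases p with
  | nil => simp at hp
  | @cons _ z _ hz q =>
    refine ⟨z, hz.symm, ?_⟩
    have h1 : q.length = r := by simpa using hp
    have h2 := G.dist_le q
    have h3 := hz.diff_dist_adj (u := x₀)
    rw [dist_comm] at h2
    omega

theorem Connected.finite_setOf_dist_le [G.LocallyFinite] (hG : G.Connected) (x₀ : V) (r : ℕ) :
    {x | G.dist x₀ x ≤ r}.Finite := by
  induction r with
  | zero =>
    refine (Set.finite_singleton x₀).subset fun x hx => ?_
    exact (hG.dist_eq_zero_iff.1 (Nat.le_zero.1 hx)).symm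
  | succ r ih =>
    refine (ih.union (ih.biUnion fun z _ => (G.neighborFinset z).finite_toSet)).subset
      fun x hx => ?_
    rcases Nat.lt_or_ge r (G.dist x₀ x) with h | h
    · obtain ⟨z, hz, hz'⟩ := hG.exists_adj_dist_add_one (le_antisymm hx h)
      refine Or.inr (Set.mem_biUnion (show G.dist x₀ z ≤ r from hz'.le) ?_)
      simpa using hz
    · exact Or.inl h

theorem Connected.finite_setOf_dist_eq [G.LocallyFinite] (hG : G.Connected) (x₀ : V) (r : ℕ) :
    {x | G.dist x₀ x = r}.Finite :=
  (hG.finite_setOf_dist_le x₀ r).subset fun _ h => le_of_eq h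

/-- Balls are finite, so some vertex lies beyond radius `r`; descending from it one sphere at a time
meets every smaller radius. -/
theorem Connected.exists_dist_eq [Infinite V] [G.LocallyFinite] (hG : G.Connected) (x₀ : V)
    (r : ℕ) : ∃ x, G.dist x₀ x = r := by
  obtain ⟨x, hx⟩ := (hG.finite_setOf_dist_le x₀ r).exists_notMem
  have key : ∀ n y, G.dist x₀ y = r + n → ∃ x, G.dist x₀ x = r := by
    intro n
    induction n with
    | zero => exact fun y hy => ⟨y, hy⟩
    | succ n ih =>
      intro y hy
      obtain ⟨z, -, hz⟩ := hG.exists_adj_dist_add_one (r := r + n) hy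
      exact ih z hz
  have hx' : r < G.dist x₀ x := not_le.1 hx
  exact key (G.dist x₀ x - r) x (by omega)

theorem Connected.sphereArea_pos [Infinite V] [G.LocallyFinite] (hG : G.Connected) (x₀ : V)
    (r : ℕ) : 0 < G.sphereArea x₀ r :=
  (Set.ncard_pos (hG.finite_setOf_dist_eq x₀ r)).2 (hG.exists_dist_eq x₀ r)

open scoped Classical in
theorem outerDegree_eq_card [G.LocallyFinite] (x₀ x : V) : G.outerDegree x₀ x =
    ((G.neighborFinset x).filter fun y => G.dist x₀ y = G.dist x₀ x + 1).card := by
  rw [outerDegree, ← Set.ncard_coe_finset]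
  congr 1
  ext y
  simp

open scoped Classical in
theorem innerDegree_eq_card [G.LocallyFinite] (x₀ x : V) : G.innerDegree x₀ x =
    ((G.neighborFinset x).filter fun y => G.dist x₀ y + 1 = G.dist x₀ x).card := by
  rw [innerDegree, ← Set.ncard_coe_finset]
  congr 1
  ext y
  simp

/-- The Laplacian of a radial function. -/
theorem laplacian_comp_dist [G.LocallyFinite] (x₀ x : V) (h : ℕ → ℝ) :
    G.laplacian (fun y => h (G.dist x₀ y)) x
      = G.outerDegree x₀ x * (h (G.dist x₀ x) - h (G.dist x₀ x + 1))
        + G.innerDegree x₀ x * (h (G.dist x₀ x) - h (G.dist x₀ x - 1)) := by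
  classical
  rw [outerDegree_eq_card, innerDegree_eq_card, ← nsmul_eq_mul, ← nsmul_eq_mul,
    ← Finset.sum_const, ← Finset.sum_const, Finset.sum_filter, Finset.sum_filter,
    ← Finset.sum_add_distrib]
  refine Finset.sum_congr rfl fun y hy => ?_
  have hd := ((G.mem_neighborFinset x y).1 hy).diff_dist_adj (u := x₀)
  beta_reduce
  generalize G.dist x₀ y = a at hd ⊢
  generalize G.dist x₀ x = b at hd ⊢
  rcases hd with rfl | rfl | rfl
  · simp
  · simp [show b + 1 + 1 ≠ b by omega]
  -- At `b = 0` truncated subtraction makes this the case of equal distances, where all terms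
  -- vanish.
  · rcases b with _ | b
    · simp
    · simp [show b ≠ b + 1 + 1 by omega]

/-! ### The radial solution of `Δ v = -1` under spherical symmetry -/

namespace IsSphericallySymmetric

variable [G.LocallyFinite] {x₀ : V} {kPlus kMinus : ℕ → ℕ}

/-- Ensures that the quotients in the series are genuine, not the default value of division by zero.
-/
theorem kPlus_pos [Infinite V] (hsym : G.IsSphericallySymmetric x₀ kPlus kMinus)
    (hG : G.Connected) (r : ℕ) : 0 < kPlus r := by
  classical
  obtain ⟨y, hy⟩ := hG.exists_dist_eq x₀ (r + 1)
  obtain ⟨z, hz, rfl⟩ := hG.exists_adj_dist_add_one hy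
  rw [← (hsym z).1, outerDegree_eq_card]
  exact Finset.card_pos.2 ⟨y, by simp [hz, hy]⟩

/-- Both sides count the edges between two consecutive spheres. -/
theorem kPlus_mul_sphereArea (hsym : G.IsSphericallySymmetric x₀ kPlus kMinus)
    (hG : G.Connected) (r : ℕ) :
    kPlus r * G.sphereArea x₀ r = kMinus (r + 1) * G.sphereArea x₀ (r + 1) := by
  classical
  have hs : ∀ r, G.sphereArea x₀ r = (hG.finite_setOf_dist_eq x₀ r).toFinset.card := fun r =>
    Set.ncard_eq_toFinset_card _ _
  rw [hs, hs, mul_comm, mul_comm (kMinus _)]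
  refine Finset.card_mul_eq_card_mul G.Adj (fun a ha => ?_) fun b hb => ?_
  · have ha' : G.dist x₀ a = r := by simpa using ha
    rw [← ha', ← (hsym a).1, outerDegree_eq_card]
    congr 1
    ext y
    simp [Finset.mem_bipartiteAbove, and_comm]
  · have hb' : G.dist x₀ b = r + 1 := by simpa using hb
    rw [← hb', ← (hsym b).2, innerDegree_eq_card]
    congr 1
    ext y
    simp [Finset.mem_bipartiteBelow, hb', and_comm, G.adj_comm]

/-- The partial sums of `V(r) / (k₊(r) S(r))` form a radial function with `Δ v = -1`. -/
theorem laplacian_sum_range [Infinite V] (hsym : G.IsSphericallySymmetric x₀ kPlus kMinus)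
    (hG : G.Connected) (x : V) :
    G.laplacian (fun y => ∑ i ∈ Finset.range (G.dist x₀ y),
      (G.ballVolume x₀ i : ℝ) / ((kPlus i : ℝ) * (G.sphereArea x₀ i : ℝ))) x = -1 := by
  rw [laplacian_comp_dist x₀ x fun r => ∑ i ∈ Finset.range r,
      (G.ballVolume x₀ i : ℝ) / ((kPlus i : ℝ) * (G.sphereArea x₀ i : ℝ)),
    (hsym x).1, (hsym x).2]
  have hS : ∀ r, (G.sphereArea x₀ r : ℝ) ≠ 0 := fun r =>
    Nat.cast_ne_zero.2 (hG.sphereArea_pos x₀ r).ne'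
  have hk : ∀ r, (kPlus r : ℝ) ≠ 0 := fun r => Nat.cast_ne_zero.2 (hsym.kPlus_pos hG r).ne'
  generalize G.dist x₀ x = r
  rcases r with _ | r
  · have h0 := hS 0
    have h1 := hk 0
    simp [ballVolume]
    field_simp
  · have he : (kPlus r : ℝ) * G.sphereArea x₀ r = kMinus (r + 1) * G.sphereArea x₀ (r + 1) := by
      exact_mod_cast hsym.kPlus_mul_sphereArea hG r
    have hV : (G.ballVolume x₀ (r + 1) : ℝ) = G.ballVolume x₀ r + G.sphereArea x₀ (r + 1) := by
      rw [ballVolume, Finset.sum_range_succ]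
      push_cast [ballVolume]
      rfl
    have hm : (kMinus (r + 1) : ℝ) ≠ 0 := fun h0 => by
      rw [h0, zero_mul] at he
      exact mul_ne_zero (hk r) (hS r) he
    have h1 := hS (r + 1)
    have h2 := hk (r + 1)
    -- By the edge count `he`, the inward flux is `V(r) / S(r+1)` and the outward one `V(r+1) /
    -- S(r+1)`; they differ by exactly one.
    rw [Finset.sum_range_succ _ (r + 1), Nat.add_sub_cancel, Finset.sum_range_succ _ r, he, hV]
    field_simp
    ring

end IsSphericallySymmetric

end Spheres

end SimpleGraph

/-! ### The criterion -/

theorem theorem4p3 {V : Type*} [Infinite V] (G : SimpleGraph V) [G.LocallyFinite]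
    (hG : G.Connected) (x₀ : V) (kPlus kMinus : ℕ → ℕ)
    (hsym : G.IsSphericallySymmetric x₀ kPlus kMinus) :
    G.StochasticallyIncomplete ↔
      Summable (fun r : ℕ =>
        (G.ballVolume x₀ r : ℝ) / ((kPlus r : ℝ) * (G.sphereArea x₀ r : ℝ))) := by
  set a : ℕ → ℝ := fun r => (G.ballVolume x₀ r : ℝ) / ((kPlus r : ℝ) * (G.sphereArea x₀ r : ℝ))
  have ha : ∀ r, 0 ≤ a r := fun r => by positivity
  set v : V → ℝ := fun y => ∑ i ∈ Finset.range (G.dist x₀ y), a i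
  have hv : ∀ x, G.laplacian v x = -1 := hsym.laplacian_sum_range hG
  have hv0 : ∀ x, 0 ≤ v x := fun x => Finset.sum_nonneg fun i _ => ha i
  constructor
  · rintro ⟨t, ht, x, hx⟩
    by_contra hns
    have htop := (not_summable_iff_tendsto_nat_atTop_of_nonneg ha).1 hns
    refine hx.not_ge (ENNReal.le_of_forall_pos_le_add fun ε hε _ => ?_)
    -- The ball of radius `n` contains `x`, and `R`, the `n`-th partial sum, is so large that the
    -- loss `(t + v x) / R` is at most `ε`.
    obtain ⟨n, hn, hxn⟩ := ((htop.eventually_ge_atTop ((t + v x) / ε)).and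
      (Filter.eventually_ge_atTop (G.dist x₀ x))).exists
    have htv : 0 < t + v x := by linarith [hv0 x]
    have hε' : (0 : ℝ) < ε := hε
    have hR := (div_pos htv hε').trans_le hn
    have h1 := SimpleGraph.le_sum_dirichletHeatKernel hv hv0 hR ht.le
      (D := (hG.finite_setOf_dist_le x₀ n).toFinset) (x := x) (fun y hy => ?_) (by simpa using hxn)
    · have h2 : (t + v x) / ∑ i ∈ Finset.range n, a i ≤ ε := by
        rw [div_le_iff₀ hR, mul_comm]
        exact (div_le_iff₀ hε').1 hn
      refine le_trans ?_ (add_le_add_left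
        (SimpleGraph.sum_dirichletHeatKernel_le_tsum
        (hG.finite_setOf_dist_le x₀ n).toFinset ht.le x) _)
      rw [← ENNReal.ofReal_one, ← ENNReal.ofReal_coe_nnreal, ← ENNReal.ofReal_add
        (Finset.sum_nonneg fun y _ => SimpleGraph.dirichletHeatKernel_nonneg _ ht.le x y) hε'.le]
      exact ENNReal.ofReal_le_ofReal (by linarith)
    · have hy' : n < G.dist x₀ y := by simpa using hy
      exact Finset.sum_le_sum_of_subset_of_nonneg (Finset.range_mono hy'.le) fun i _ _ => ha i
  · intro hs
    have hM : ∀ x, v x ≤ ∑' i, a i := fun x => hs.sum_le_tsum _ fun i _ => ha i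
    have hM0 : 0 ≤ ∑' i, a i := tsum_nonneg ha
    -- With `M` the sum of the series, the time `M + 1` bounds the mass at `x₀` by `M / (M + 1)`.
    have hT : 0 < ∑' i, a i + 1 := by linarith
    refine ⟨_, hT, x₀, (SimpleGraph.tsum_heatKernel_le hT.le fun D hD =>
      SimpleGraph.sum_dirichletHeatKernel_le hv hM hT hD).trans_lt ?_⟩
    rw [← ENNReal.ofReal_one, ENNReal.ofReal_lt_ofReal_iff one_pos, div_lt_one hT]
    linarith [hv0 x₀]
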